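/- Call a function $f:\mathbb N^k\to\mathbb N$ primitive recursive if it belongs to the smallest class of number-theoretic functions that contains the constant zero, the successor function and the projections and is closed under composition and (ordinary) primitive recursion. The class of primitive recursive functions is closed under the following three schemes, where $n\ge 0$ is arbitrary, $\vec y=(y_1,\dots,y_n)$ and $\vec z=(z_1,\dots,z_n)$. 1. Primitive recursion with parameter substitution: if $g:\mathbb N^n\to\mathbb N$, $p_1,\dots,p_n:\mathbb N^{n+1}\to\mathbb N$ and $h:\mathbb N^{n+2}\to\mathbb N$ are primitive recursive, and $f:\mathbb N^{n+1}\to\mathbb N$ satisfies, for all $x,\vec y$, $$f(0,\vec y)=g(\vec y),\qquad f(x+1,\vec y)=h\bigl(x,\vec y,f(x,\vec p(x,\vec y))\bigr),$$ where $\vec p=(p_1,\dots,p_n)$, then $f$ is primitive recursive. 2. Unnested multiple recursion: if $g_0,q:\mathbb N^{n+1}\to\mathbb N$, $g_1,p:\mathbb N^{n+2}\to\mathbb N$ and $h:\mathbb N^{n+4}\to\mathbb N$ are primitive recursive, and $f:\mathbb N^{n+2}\to\mathbb N$ satisfies, for all $x,y,\vec z$, $$f(0,y,\vec z)=g_0(y,\vec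 z),\qquad f(x+1,0,\vec z)=g_1\bigl(x,f(x,q(x,\vec z),\vec z),\vec z\bigr),$$ $$f(x+1,y+1,\vec z)=h\bigl(x,y,f(x,p(x,y,\vec z),\vec z),f(x+1,y,\vec z),\vec z\bigr),$$ then $f$ is primitive recursive. 3. Simple nested recursion: if $g:\mathbb N^n\to\mathbb N$, $p_1,\dots,p_n:\mathbb N^{n+2}\to\mathbb N$ and $h:\mathbb N^{n+2}\to\mathbb N$ are primitive recursive, and $f:\mathbb N^{n+1}\to\mathbb N$ satisfies, for all $x,\vec y$, $$f(0,\vec y)=g(\vec y),\qquad f(x+1,\vec y)=h\bigl(x,\vec y,f(x,\vec p(x,\vec y,f(x,\vec y)))\bigr),$$ where $\vec p=(p_1,\dots,p_n)$, then $f$ is primitive recursive. -/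

import Mathlib

open scoped List.Vector

/-- `f : ℕ^(n+1) → ℕ` is obtained from `g`, `p = (p₁, …, pₙ)` and `h` by primitive recursion with
parameter substitution:
`f(0, y) = g(y)` and `f(x+1, y) = h(x, y, f(x, p(x, y)))`, where `y = (y₁, …, yₙ)`. -/
def IsPRP {n : ℕ} (g : List.Vector ℕ n → ℕ) (p : Fin n → List.Vector ℕ (n + 1) → ℕ)
    (h : List.Vector ℕ (n + 2) → ℕ) (f : List.Vector ℕ (n + 1) → ℕ) : Prop :=
  (∀ y : List.Vector ℕ n, f (0 ::ᵥ y) = g y) ∧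
  ∀ (x : ℕ) (y : List.Vector ℕ n),
    f ((x + 1) ::ᵥ y) =
      h (x ::ᵥ y.snoc (f (x ::ᵥ List.Vector.ofFn fun i => p i (x ::ᵥ y))))

/-- `f : ℕ^(n+2) → ℕ` is obtained from `g₀`, `g₁`, `q`, `p` and `h` by unnested multiple
recursion, with passive parameters `z = (z₁, …, zₙ)`:
`f(0, y, z) = g₀(y, z)`,
`f(x+1, 0, z) = g₁(x, f(x, q(x, z), z), z)` and
`f(x+1, y+1, z) = h(x, y, f(x, p(x, y, z), z), f(x+1, y, z), z)`. -/
def IsUMR {n : ℕ} (g₀ : List.Vector ℕ (n + 1) → ℕ) (g₁ : List.Vector ℕ (n + 2) → ℕ)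
    (q : List.Vector ℕ (n + 1) → ℕ) (p : List.Vector ℕ (n + 2) → ℕ)
    (h : List.Vector ℕ (n + 4) → ℕ) (f : List.Vector ℕ (n + 2) → ℕ) : Prop :=
  (∀ (y : ℕ) (z : List.Vector ℕ n), f (0 ::ᵥ y ::ᵥ z) = g₀ (y ::ᵥ z)) ∧
  (∀ (x : ℕ) (z : List.Vector ℕ n),
    f ((x + 1) ::ᵥ 0 ::ᵥ z) = g₁ (x ::ᵥ f (x ::ᵥ q (x ::ᵥ z) ::ᵥ z) ::ᵥ z)) ∧
  ∀ (x y : ℕ) (z : List.Vector ℕ n),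
    f ((x + 1) ::ᵥ (y + 1) ::ᵥ z) =
      h (x ::ᵥ y ::ᵥ f (x ::ᵥ p (x ::ᵥ y ::ᵥ z) ::ᵥ z) ::ᵥ f ((x + 1) ::ᵥ y ::ᵥ z) ::ᵥ z)

/-- `f : ℕ^(n+1) → ℕ` is obtained from `g`, `p = (p₁, …, pₙ)` and `h` by simple nested recursion:
`f(0, y) = g(y)` and `f(x+1, y) = h(x, y, f(x, p(x, y, f(x, y))))`, where `y = (y₁, …, yₙ)`. -/
def IsSNR {n : ℕ} (g : List.Vector ℕ n → ℕ) (p : Fin n → List.Vector ℕ (n + 2) → ℕ)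
    (h : List.Vector ℕ (n + 2) → ℕ) (f : List.Vector ℕ (n + 1) → ℕ) : Prop :=
  (∀ y : List.Vector ℕ n, f (0 ::ᵥ y) = g y) ∧
  ∀ (x : ℕ) (y : List.Vector ℕ n),
    f ((x + 1) ::ᵥ y) =
      h (x ::ᵥ y.snoc
        (f (x ::ᵥ List.Vector.ofFn fun i => p i (x ::ᵥ y.snoc (f (x ::ᵥ y))))))

/-! Nested recursion makes two calls at `x` for each call at `x + 1`, whatever the parameters and
the intermediate values are. Its evaluation on a stack therefore takes a number of steps that
depends on `x` alone and is primitive recursive, so iterating a primitive recursive step function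
computes `f`. Parameter substitution is the case where `p` ignores the value of the first call. For
unnested multiple recursion, a finite initial segment of the row at `x + 1` is determined by a
longer one of the row at `x`; the required length acts as a substituted parameter. -/

open Primrec in
/-- Simple nested recursion over primitively encodable types. The proof evaluates the recursion on a
stack machine. A frame `(t, x, y)` with tag `t = 0` asks for the value at `(x, y)`; the tags `1` and
`2` mark the work that remains at `(x + 1, y)` after the first and the second recursive call. -/
theorem Primrec.nested_rec {β σ : Type*} [Primcodable β] [Primcodable σ] [Inhabited σ]
    {f : ℕ → β → σ} {g : β → σ} {p : ℕ × β × σ → β} {h : ℕ × β × σ → σ}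
    (hg : Primrec g) (hp : Primrec p) (hh : Primrec h) (f_zero : ∀ y, f 0 y = g y)
    (f_succ : ∀ x y, f (x + 1) y = h (x, y, f x (p (x, y, f x y)))) : Primrec₂ f := by
  let Frame := ℕ × ℕ × β
  -- `v` is the value returned last: `f x y` when tag `1` is popped, the value of the second call
  -- when tag `2` is.
  let run (v : σ) (a : Frame) (s : List Frame) : List Frame × σ :=
    Nat.casesOn a.1
      (Nat.casesOn a.2.1 (s, g a.2.2) fun x => ((0, x, a.2.2) :: (1, x, a.2.2) :: s, v))
      fun t => Nat.casesOn t
        ((0, a.2.1, p (a.2.1, a.2.2, v)) :: (2, a.2.1, a.2.2) :: s, v)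
        fun _ => (s, h (a.2.1, a.2.2, v))
  let step (c : List Frame × σ) : List Frame × σ :=
    List.casesOn c.1 c fun a s => run c.2 a s
  -- Two calls at `x`, and one step for each of the three tags.
  let time (x : ℕ) : ℕ := Nat.rec 1 (fun _ T => T + T + 3) x
  have hrun : Primrec fun c : σ × Frame × List Frame => run c.1 c.2.1 c.2.2 := by
    have hv : Primrec fun c : σ × Frame × List Frame => c.1 := fst
    have hs : Primrec fun c : σ × Frame × List Frame => c.2.2 := snd.comp snd
    have ha : Primrec fun c : σ × Frame × List Frame => c.2.1 := fst.comp snd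
    have ht : Primrec fun c : σ × Frame × List Frame => c.2.1.1 := fst.comp ha
    have hx : Primrec fun c : σ × Frame × List Frame => c.2.1.2.1 := fst.comp (snd.comp ha)
    have hy : Primrec fun c : σ × Frame × List Frame => c.2.1.2.2 := snd.comp (snd.comp ha)
    have harg : Primrec fun c : σ × Frame × List Frame => (c.2.1.2.1, c.2.1.2.2, c.1) :=
      hx.pair (hy.pair hv)
    refine nat_casesOn ht (nat_casesOn hx (hs.pair (hg.comp hy)) ?_) ?_
    · exact (list_cons.comp ((const 0).pair (snd.pair (hy.comp fst)))
        (list_cons.comp ((const 1).pair (snd.pair (hy.comp fst))) (hs.comp fst))).pair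
        (hv.comp fst)
    · refine nat_casesOn snd ?_ ?_
      · exact ((list_cons.comp ((const 0).pair (hx.pair (hp.comp harg)))
          (list_cons.comp ((const 2).pair (hx.pair hy)) hs)).pair hv).comp fst
      · exact ((hs.pair (hh.comp harg)).comp fst).comp fst
  have hstep : Primrec step :=
    list_casesOn (f := fun c : List Frame × σ => c.1) (g := id)
      (h := fun c a => run c.2 a.1 a.2) fst .id (hrun.comp ((snd.comp fst).pair snd))
  have htime : Primrec time :=
    nat_rec₁ 1 (nat_add.comp (nat_add.comp snd snd) (const 3))
  -- Arbitrary `s` and `v` let the induction hypothesis apply to both calls, made above pending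
  -- frames.
  have eval : ∀ x y s v, step^[time x] ((0, x, y) :: s, v) = (s, f x y) := by
    intro x
    induction x with
    | zero => intro y s v; rw [f_zero]; rfl
    | succ x ih =>
      intro y s v
      have : time (x + 1) = 1 + (time x + (1 + (time x + 1))) := by
        change time x + time x + 3 = _
        omega
      have start : step ((0, x + 1, y) :: s, v) = ((0, x, y) :: (1, x, y) :: s, v) := rfl
      have middle (w : σ) : step ((1, x, y) :: s, w) =
          ((0, x, p (x, y, w)) :: (2, x, y) :: s, w) := rfl
      have finish (w : σ) : step ((2, x, y) :: s, w) = (s, h (x, y, w)) := rfl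
      rw [this, Nat.add_comm 1, Function.iterate_add_apply, Function.iterate_one, start,
        Nat.add_comm (time x), Function.iterate_add_apply, ih,
        Nat.add_comm 1, Function.iterate_add_apply, Function.iterate_one, middle,
        Nat.add_comm (time x), Function.iterate_add_apply, ih, Function.iterate_one, finish,
        f_succ]
  have : Primrec fun a : ℕ × β => (step^[time a.1] ([(0, a.1, a.2)], default)).2 :=
    snd.comp (nat_iterate (htime.comp fst)
      ((list_cons.comp ((const 0).pair .id) (const [])).pair (const default))
      (hstep.comp snd))
  exact this.of_eq fun a => by rw [eval]

/-- Primitive recursion with parameter substitution over primitively encodable types. -/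
theorem Primrec.param_subst_rec {β σ : Type*} [Primcodable β] [Primcodable σ] [Inhabited σ]
    {f : ℕ → β → σ} {g : β → σ} {p : ℕ × β → β} {h : ℕ × β × σ → σ}
    (hg : Primrec g) (hp : Primrec p) (hh : Primrec h) (f_zero : ∀ y, f 0 y = g y)
    (f_succ : ∀ x y, f (x + 1) y = h (x, y, f x (p (x, y)))) : Primrec₂ f :=
  Primrec.nested_rec (p := fun a => p (a.1, a.2.1)) hg
    (hp.comp (Primrec.fst.pair (Primrec.fst.comp Primrec.snd))) hh f_zero f_succ

open Primrec in
/-- Unnested multiple recursion over primitively encodable types. The table of the values of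
`f x · z` up to a given argument is obtained by primitive recursion with parameter substitution. -/
theorem Primrec.unnested_rec {γ σ : Type*} [Primcodable γ] [Primcodable σ] [Inhabited σ]
    {f : ℕ → ℕ × γ → σ} {g₀ : ℕ × γ → σ} {g₁ : ℕ × σ × γ → σ} {q : ℕ × γ → ℕ}
    {p : ℕ × ℕ × γ → ℕ} {h : ℕ × ℕ × σ × σ × γ → σ}
    (hg₀ : Primrec g₀) (hg₁ : Primrec g₁) (hq : Primrec q) (hp : Primrec p) (hh : Primrec h)
    (f_zero : ∀ y z, f 0 (y, z) = g₀ (y, z))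
    (f_succ_zero : ∀ x z, f (x + 1) (0, z) = g₁ (x, f x (q (x, z), z), z))
    (f_succ_succ : ∀ x y z,
      f (x + 1) (y + 1, z) = h (x, y, f x (p (x, y, z), z), f (x + 1) (y, z), z)) :
    Primrec₂ f := by
  -- A sum serves as an upper bound for all arguments at which row `x` is consulted.
  let bound (x y : ℕ) (z : γ) : ℕ := Nat.rec (q (x, z)) (fun y b => b + p (x, y, z)) y
  -- Row `x + 1`, with `L` standing for row `x`; the default is never read if `L` is long enough.
  let row (x : ℕ) (z : γ) (L : List σ) (y : ℕ) : σ :=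
    Nat.rec (g₁ (x, L.getD (q (x, z)) default, z))
      (fun y v => h (x, y, L.getD (p (x, y, z)) default, v, z)) y
  let table (x : ℕ) (a : ℕ × γ) : List σ := (List.range (a.1 + 1)).map fun y => f x (y, a.2)
  have hbound : Primrec fun a : ℕ × ℕ × γ => bound a.1 a.2.1 a.2.2 :=
    nat_rec' (h := fun a b => b.2 + p (a.1, b.1, a.2.2)) (fst.comp snd)
      (hq.comp (fst.pair (snd.comp snd)))
      (nat_add.comp (snd.comp snd) (hp.comp ((fst.comp fst).pair
        ((fst.comp snd).pair (snd.comp (snd.comp fst))))))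
  have hrow : Primrec fun a : (ℕ × (ℕ × γ) × List σ) × ℕ => row a.1.1 a.1.2.1.2 a.1.2.2 a.2 := by
    have hx : Primrec fun a : (ℕ × (ℕ × γ) × List σ) × ℕ => a.1.1 := fst.comp fst
    have hz : Primrec fun a : (ℕ × (ℕ × γ) × List σ) × ℕ => a.1.2.1.2 :=
      snd.comp (fst.comp (snd.comp fst))
    have hL : Primrec fun a : (ℕ × (ℕ × γ) × List σ) × ℕ => a.1.2.2 :=
      snd.comp (snd.comp fst)
    have hy : Primrec fun a : ((ℕ × (ℕ × γ) × List σ) × ℕ) × ℕ × σ =>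
        (a.1.1.1, a.2.1, a.1.1.2.1.2) :=
      (hx.comp fst).pair ((fst.comp snd).pair (hz.comp fst))
    have hLq : Primrec fun a : (ℕ × (ℕ × γ) × List σ) × ℕ =>
        a.1.2.2.getD (q (a.1.1, a.1.2.1.2)) default :=
      (list_getD default).comp hL (hq.comp (hx.pair hz))
    have hLp : Primrec fun a : ((ℕ × (ℕ × γ) × List σ) × ℕ) × ℕ × σ =>
        a.1.1.2.2.getD (p (a.1.1.1, a.2.1, a.1.1.2.1.2)) default :=
      (list_getD default).comp (hL.comp fst) (hp.comp hy)
    have h_zero : Primrec fun a : (ℕ × (ℕ × γ) × List σ) × ℕ =>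
        g₁ (a.1.1, a.1.2.2.getD (q (a.1.1, a.1.2.1.2)) default, a.1.2.1.2) :=
      hg₁.comp (hx.pair (hLq.pair hz))
    have h_succ : Primrec₂ fun (a : (ℕ × (ℕ × γ) × List σ) × ℕ) (b : ℕ × σ) =>
        h (a.1.1, b.1, a.1.2.2.getD (p (a.1.1, b.1, a.1.2.1.2)) default, b.2, a.1.2.1.2) :=
      hh.comp ((hx.comp fst).pair ((fst.comp snd).pair (hLp.pair
        ((snd.comp snd).pair (hz.comp fst)))))
    have := nat_rec' snd h_zero h_succ
    exact this
  have q_le (x y : ℕ) (z : γ) : q (x, z) ≤ bound x y z := by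
    induction y with
    | zero => exact le_rfl
    | succ y ih => exact ih.trans (Nat.le_add_right _ _)
  have p_le (x : ℕ) (z : γ) {y y' : ℕ} (hy : y' < y) : p (x, y', z) ≤ bound x y z := by
    induction y with
    | zero => omega
    | succ y ih =>
      change _ ≤ bound x y z + p (x, y, z)
      rcases Nat.lt_succ_iff_lt_or_eq.1 hy with hy | rfl
      · exact (ih hy).trans (Nat.le_add_right _ _)
      · exact Nat.le_add_left _ _
  have getD_table (x b : ℕ) (z : γ) {i : ℕ} (hi : i ≤ b) :
      (table x (b, z)).getD i default = f x (i, z) := by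
    simp [table, List.getD_eq_getElem?_getD, List.getElem?_range (Nat.lt_succ_of_le hi)]
  -- The table stays fixed, sized for `y`, while the induction runs over `y'`.
  have row_table (x y : ℕ) (z : γ) {y' : ℕ} (hy : y' ≤ y) :
      row x z (table x (bound x y z, z)) y' = f (x + 1) (y', z) := by
    induction y' with
    | zero =>
      rw [f_succ_zero, ← getD_table x _ z (q_le x y z)]
      rfl
    | succ y' ih =>
      rw [f_succ_succ, ← ih (Nat.le_of_succ_le hy), ← getD_table x _ z (p_le x z hy)]
  have htable : Primrec₂ table := by
    refine param_subst_rec (g := fun a => (List.range (a.1 + 1)).map fun y => g₀ (y, a.2))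
      (p := fun a => (bound a.1 a.2.1 a.2.2, a.2.2))
      (h := fun a => (List.range (a.2.1.1 + 1)).map (row a.1 a.2.1.2 a.2.2)) ?_ ?_ ?_ ?_ ?_
    · exact list_map (list_range.comp (succ.comp fst)) (hg₀.comp (snd.pair (snd.comp fst)))
    · exact hbound.pair (snd.comp snd)
    · exact list_map (list_range.comp (succ.comp (fst.comp (fst.comp snd)))) hrow
    · intro a
      exact List.map_congr_left fun y _ => f_zero y a.2
    · intro x a
      exact List.map_congr_left fun y hy =>
        (row_table x a.1 a.2 (Nat.lt_succ_iff.1 (List.mem_range.1 hy))).symm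
  have : Primrec fun a : ℕ × ℕ × γ => (table a.1 a.2).getD a.2.1 default :=
    (list_getD default).comp htable (fst.comp snd)
  exact this.of_eq fun a => getD_table a.1 a.2.1 a.2.2 le_rfl

theorem Primrec.vector_snoc {α : Type*} [Primcodable α] {n : ℕ} :
    Primrec₂ (@List.Vector.snoc α n) :=
  Primrec.vector_toList_iff.1 <|
    (Primrec.list_concat.comp (Primrec.vector_toList.comp Primrec.fst) Primrec.snd).of_eq fun a => by
      simp [List.Vector.snoc]

open Primrec in
theorem IsSNR.primrec' {n : ℕ} {g : List.Vector ℕ n → ℕ} {p : Fin n → List.Vector ℕ (n + 2) → ℕ}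
    {h : List.Vector ℕ (n + 2) → ℕ} {f : List.Vector ℕ (n + 1) → ℕ}
    (hg : Nat.Primrec' g) (hp : ∀ i, Nat.Primrec' (p i)) (hh : Nat.Primrec' h)
    (hf : IsSNR g p h f) : Nat.Primrec' f := by
  have args : Primrec fun a : ℕ × List.Vector ℕ n × ℕ => a.1 ::ᵥ a.2.1.snoc a.2.2 :=
    vector_cons.comp fst (vector_snoc.comp (fst.comp snd) (snd.comp snd))
  have : Primrec₂ fun (x : ℕ) (y : List.Vector ℕ n) => f (x ::ᵥ y) :=
    nested_rec hg.to_prim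
      (p := fun a => List.Vector.ofFn fun i => p i (a.1 ::ᵥ a.2.1.snoc a.2.2))
      (vector_ofFn fun i => (hp i).to_prim.comp args) (hh.to_prim.comp args) hf.1 hf.2
  exact Nat.Primrec'.of_prim <| (this.comp vector_head vector_tail).of_eq fun v => by
    rw [List.Vector.cons_head_tail]

open Primrec in
theorem IsPRP.primrec' {n : ℕ} {g : List.Vector ℕ n → ℕ} {p : Fin n → List.Vector ℕ (n + 1) → ℕ}
    {h : List.Vector ℕ (n + 2) → ℕ} {f : List.Vector ℕ (n + 1) → ℕ}
    (hg : Nat.Primrec' g) (hp : ∀ i, Nat.Primrec' (p i)) (hh : Nat.Primrec' h)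
    (hf : IsPRP g p h f) : Nat.Primrec' f := by
  have : Primrec₂ fun (x : ℕ) (y : List.Vector ℕ n) => f (x ::ᵥ y) :=
    param_subst_rec hg.to_prim
      (p := fun a => List.Vector.ofFn fun i => p i (a.1 ::ᵥ a.2))
      (vector_ofFn fun i => (hp i).to_prim.comp (vector_cons.comp fst snd))
      (h := fun a => h (a.1 ::ᵥ a.2.1.snoc a.2.2))
      (hh.to_prim.comp
        (vector_cons.comp fst (vector_snoc.comp (fst.comp snd) (snd.comp snd)))) hf.1 hf.2
  exact Nat.Primrec'.of_prim <| (this.comp vector_head vector_tail).of_eq fun v => by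
    rw [List.Vector.cons_head_tail]

open Primrec in
theorem IsUMR.primrec' {n : ℕ} {g₀ : List.Vector ℕ (n + 1) → ℕ} {g₁ : List.Vector ℕ (n + 2) → ℕ}
    {q : List.Vector ℕ (n + 1) → ℕ} {p : List.Vector ℕ (n + 2) → ℕ}
    {h : List.Vector ℕ (n + 4) → ℕ} {f : List.Vector ℕ (n + 2) → ℕ}
    (hg₀ : Nat.Primrec' g₀) (hg₁ : Nat.Primrec' g₁) (hq : Nat.Primrec' q) (hp : Nat.Primrec' p)
    (hh : Nat.Primrec' h) (hf : IsUMR g₀ g₁ q p h f) : Nat.Primrec' f := by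
  have args₁ : Primrec fun a : ℕ × List.Vector ℕ n => a.1 ::ᵥ a.2 := vector_cons
  have args₂ : Primrec fun a : ℕ × ℕ × List.Vector ℕ n => a.1 ::ᵥ a.2.1 ::ᵥ a.2.2 :=
    vector_cons.comp fst (args₁.comp snd)
  have args₄ : Primrec fun a : ℕ × ℕ × ℕ × ℕ × List.Vector ℕ n =>
      a.1 ::ᵥ a.2.1 ::ᵥ a.2.2.1 ::ᵥ a.2.2.2.1 ::ᵥ a.2.2.2.2 :=
    vector_cons.comp fst (vector_cons.comp (fst.comp snd) (args₂.comp (snd.comp snd)))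
  have : Primrec₂ fun (x : ℕ) (a : ℕ × List.Vector ℕ n) => f (x ::ᵥ a.1 ::ᵥ a.2) :=
    unnested_rec (hg₀.to_prim.comp args₁) (hg₁.to_prim.comp args₂) (hq.to_prim.comp args₁)
      (hp.to_prim.comp args₂) (hh.to_prim.comp args₄) hf.1 hf.2.1 hf.2.2
  exact Nat.Primrec'.of_prim <| (this.comp vector_head ((vector_head.comp vector_tail).pair
    (vector_tail.comp vector_tail))).of_eq fun v => by
      simp only [List.Vector.cons_head_tail]

theorem mainTheorem2 :
    (∀ (n : ℕ) (g : List.Vector ℕ n → ℕ) (p : Fin n → List.Vector ℕ (n + 1) → ℕ)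
        (h : List.Vector ℕ (n + 2) → ℕ) (f : List.Vector ℕ (n + 1) → ℕ),
      Nat.Primrec' g → (∀ i, Nat.Primrec' (p i)) → Nat.Primrec' h →
        IsPRP g p h f → Nat.Primrec' f) ∧
    (∀ (n : ℕ) (g₀ : List.Vector ℕ (n + 1) → ℕ) (g₁ : List.Vector ℕ (n + 2) → ℕ)
        (q : List.Vector ℕ (n + 1) → ℕ) (p : List.Vector ℕ (n + 2) → ℕ)
        (h : List.Vector ℕ (n + 4) → ℕ) (f : List.Vector ℕ (n + 2) → ℕ),
      Nat.Primrec' g₀ → Nat.Primrec' g₁ → Nat.Primrec' q → Nat.Primrec' p → Nat.Primrec' h →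
        IsUMR g₀ g₁ q p h f → Nat.Primrec' f) ∧
    (∀ (n : ℕ) (g : List.Vector ℕ n → ℕ) (p : Fin n → List.Vector ℕ (n + 2) → ℕ)
        (h : List.Vector ℕ (n + 2) → ℕ) (f : List.Vector ℕ (n + 1) → ℕ),
      Nat.Primrec' g → (∀ i, Nat.Primrec' (p i)) → Nat.Primrec' h →
        IsSNR g p h f → Nat.Primrec' f) := by
  exact ⟨fun _ _ _ _ _ hg hp hh hf => hf.primrec' hg hp hh,
    fun _ _ _ _ _ _ _ hg₀ hg₁ hq hp hh hf => hf.primrec' hg₀ hg₁ hq hp hh,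
    fun _ _ _ _ _ hg hp hh hf => hf.primrec' hg hp hh⟩
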